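/- Let $S=(-\frac{\pi}{2},\frac{\pi}{2})^2\subset\mathbb R^2$ and let $z_0=(\pm\frac{\pi}{2},\pm\frac{\pi}{2})$ be one of its corners. Let $D$ be the diagonal of $\overline S$ through $z_0$ (the part in $\overline S$ of the line $y=x$ or $y=-x$). Let $\theta_0\in\mathbb R$ and $h_0,\epsilon_1,\eta_1>0$. For $|\theta-\theta_0|<\eta_1$ and $h\in[0,h_0)$, let $\Phi(\cdot,\theta,h)$ be an eigenfunction of the Laplacian on $S$ with the $h$-Robin condition and eigenvalue $\lambda(h)$, that is, a function that is smooth on $\overline S$, not identically zero, and satisfies $$-\Delta\Phi(\cdot,\theta,h)=\lambda(h)\,\Phi(\cdot,\theta,h)\ \text{ in } S,\qquad \partial_\nu\Phi(\cdot,\theta,h)+h\,\Phi(\cdot,\theta,h)=0\ \text{ on the open sides of } S,$$ where $\nu$ is the outward-pointing unit normal. Suppose that $\Phi$ is jointly $C^\infty$ in $(x,y,\theta,h)$ for $(x,y)\in\overline S\cap B(z_0,\epsilon_1)$, $|\theta-\theta_0|<\eta_1$, $h\in[0,h_0)$, and that $$\Phi(z,\theta_0,h)=0\ \text{ for all } z\in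 D,\ h\in[0,h_0),\qquad \nabla\Phi(z_0,\theta_0,h)=0\ \text{ for all } h\in[0,h_0),$$ $$\partial_y^2\Phi(z_0,\theta_0,0)\neq0,\qquad \partial_\theta\Phi(z_0,\theta_0,0)\neq0$$ (derivatives in $(x,y)$ at boundary points are taken within $\overline S$). Then there exist $\epsilon_0\in(0,\epsilon_1)$ and $\eta_0\in(0,\min(\eta_1,h_0))$ such that, for all $\theta\in\mathbb R$ and $h\ge0$ with $|\theta-\theta_0|+h\le\eta_0$, the function $\Phi(\cdot,\theta,h)$ has exactly $2$ nodal domains in $B(z_0,\epsilon_0)\cap S$; that is, the set $\{z\in B(z_0,\epsilon_0)\cap S:\Phi(z,\theta,h)\ne0\}$ has exactly two connected components. -/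

import Mathlib

open scoped ContDiff

namespace RobinSquare

/-- The Euclidean plane. -/
abbrev Plane : Type := EuclideanSpace ℝ (Fin 2)

/-- The open square `S = (-π/2, π/2)²`. -/
def square : Set Plane := {z | ∀ i, |z i| < Real.pi / 2}

/-- The closed square, i.e. the closure of `S`. -/
def closedSquare : Set Plane := {z | ∀ i, |z i| ≤ Real.pi / 2}

/-- `z` is one of the four corners `(± π/2, ± π/2)` of the square. -/
def IsCorner (z : Plane) : Prop := ∀ i, |z i| = Real.pi / 2

/-- `z` lies on an open side of the square and `ν` is the outward-pointing unit normal there. -/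
def IsOutwardNormal (z ν : Plane) : Prop :=
  ∃ i : Fin 2, ∃ s : ℝ, (s = 1 ∨ s = -1) ∧ z i = s * (Real.pi / 2) ∧
    (∀ j, j ≠ i → |z j| < Real.pi / 2) ∧ ν = s • EuclideanSpace.single i (1 : ℝ)

/-- `u` is an eigenfunction, with eigenvalue `lam`, of the Laplacian on the square with the
Robin condition `∂u/∂ν + h u = 0` on the boundary. Eigenfunctions of the square are smooth up to
the boundary, and boundary derivatives are taken within the closed square. Only the values of `u`
on the closed square matter. -/
structure IsRobinEigenfunction (h lam : ℝ) (u : Plane → ℝ) : Prop where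
  smooth : ContDiffOn ℝ ∞ u closedSquare
  nontrivial : ∃ z ∈ square, u z ≠ 0
  equation : ∀ z ∈ square, -(Laplacian.laplacian u z) = lam * u z
  robin : ∀ z ν, IsOutwardNormal z ν → fderivWithin ℝ u closedSquare z ν + h * u z = 0

/-- The nodal domains of `u` in `U`: the connected components of `U` minus the zero set of `u`. -/
def nodalDomains (u : Plane → ℝ) (U : Set Plane) : Set (Set Plane) :=
  {C | ∃ z ∈ {w ∈ U | u w ≠ 0}, C = connectedComponentIn {w ∈ U | u w ≠ 0} z}

end RobinSquare

/-!
Use coordinates `(x, y)` at the corner, measuring the distances to the two sides that meet there.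
The Robin condition with parameter `h` reads `u_x = h u` on `x = 0` and `u_y = h u` on `y = 0`. For
the unperturbed function, which vanishes at the corner, it makes the gradient vanish there as well,
and the eigenvalue equation gives `u_xx = -u_yy ≠ 0`, say `u_xx < 0 < u_yy`. For nearby parameters,
near the corner, `u_x - h u` then vanishes at `x = 0` and has negative `x`-derivative, so that
`e^{-hx} u` decreases in `x`; likewise `e^{-hy} u` increases in `y`. Hence `{u > 0}` is stable under
moving towards `x = 0` and away from `y = 0`, which makes it connected, and so is `{u < 0}` by
symmetry. Neither set is empty: the unperturbed function is negative on the `x`-axis and positive on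
the `y`-axis, and this persists nearby.
-/

namespace RobinSquare

open Set Filter Topology

section NodalDomains

variable {X : Type*} [TopologicalSpace X] {u : X → ℝ} {U : Set X} {z : X}

theorem connectedComponentIn_ne_zero_of_pos (hu : ContinuousOn u U)
    (hconn : IsPreconnected {w ∈ U | 0 < u w}) (hz : z ∈ {w ∈ U | 0 < u w}) :
    connectedComponentIn {w ∈ U | u w ≠ 0} z = {w ∈ U | 0 < u w} := by
  have hsub := connectedComponentIn_subset {w ∈ U | u w ≠ 0} z
  refine Subset.antisymm (fun w hw => ⟨(hsub hw).1, ?_⟩)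
    (hconn.subset_connectedComponentIn hz fun w hw => ⟨hw.1, hw.2.ne'⟩)
  by_contra! hle
  obtain ⟨x, hx, hx0⟩ := isPreconnected_connectedComponentIn.intermediate_value hw
    (mem_connectedComponentIn ⟨hz.1, hz.2.ne'⟩) (hu.mono fun x hx => (hsub hx).1) ⟨hle, hz.2.le⟩
  exact (hsub hx).2 hx0

theorem connectedComponentIn_ne_zero_of_neg (hu : ContinuousOn u U)
    (hconn : IsPreconnected {w ∈ U | u w < 0}) (hz : z ∈ {w ∈ U | u w < 0}) :
    connectedComponentIn {w ∈ U | u w ≠ 0} z = {w ∈ U | u w < 0} := by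
  simpa using connectedComponentIn_ne_zero_of_pos (z := z) hu.neg (by simpa using hconn)
    (by simpa using hz)

theorem ncard_nodalDomains_eq_two {u : Plane → ℝ} {U : Set Plane} (hu : ContinuousOn u U)
    (hpos : IsConnected {w ∈ U | 0 < u w}) (hneg : IsConnected {w ∈ U | u w < 0}) :
    (nodalDomains u U).ncard = 2 := by
  obtain ⟨p, hp⟩ := hpos.nonempty
  obtain ⟨n, hn⟩ := hneg.nonempty
  have comp_pos := fun z => connectedComponentIn_ne_zero_of_pos (z := z) hu hpos.isPreconnected
  have comp_neg := fun z => connectedComponentIn_ne_zero_of_neg (z := z) hu hneg.isPreconnected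
  have hdomains : nodalDomains u U = {{w ∈ U | 0 < u w}, {w ∈ U | u w < 0}} := by
    ext C
    constructor
    · rintro ⟨z, ⟨hzU, hz⟩, rfl⟩
      rcases lt_or_gt_of_ne hz with hz | hz
      · exact Or.inr (comp_neg z ⟨hzU, hz⟩)
      · exact Or.inl (comp_pos z ⟨hzU, hz⟩)
    · rintro (rfl | rfl)
      · exact ⟨p, ⟨hp.1, hp.2.ne'⟩, (comp_pos p hp).symm⟩
      · exact ⟨n, ⟨hn.1, hn.2.ne⟩, (comp_neg n hn).symm⟩
  rw [hdomains, ncard_pair]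
  intro heq
  rw [heq] at hp
  exact lt_asymm hp.2 (heq ▸ hp : p ∈ {w ∈ U | 0 < u w}).2

end NodalDomains

section QuarterDisc

theorem isPreconnected_of_left_mem_of_vertical_mem {P : Set (ℝ × ℝ)} (hpos : ∀ q ∈ P, 0 < q.1)
    (hleft : ∀ ⦃x x' y⦄, (x, y) ∈ P → 0 < x' → x' ≤ x → (x', y) ∈ P)
    (hvert : ∀ ⦃x y₁ y y₂⦄, (x, y₁) ∈ P → (x, y₂) ∈ P → y ∈ Icc y₁ y₂ → (x, y) ∈ P) :
    IsPreconnected P := by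
  have joined_left : ∀ ⦃x x' y⦄, (x, y) ∈ P → 0 < x' → x' ≤ x → JoinedIn P (x, y) (x', y) := by
    intro x x' y hxy hx' hle
    refine (JoinedIn.of_segment_subset ?_).symm
    rw [← Prod.image_mk_segment_left, segment_eq_Icc hle]
    rintro _ ⟨t, ht, rfl⟩
    exact hleft hxy (hx'.trans_le ht.1) ht.2
  have joined_up : ∀ ⦃x y₁ y₂⦄, (x, y₁) ∈ P → (x, y₂) ∈ P → y₁ ≤ y₂ →
      JoinedIn P (x, y₁) (x, y₂) := by
    intro x y₁ y₂ h₁ h₂ hle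
    refine JoinedIn.of_segment_subset ?_
    rw [← Prod.image_mk_segment_right, segment_eq_Icc hle]
    rintro _ ⟨t, ht, rfl⟩
    exact hvert h₁ h₂ ht
  have joined : ∀ p ∈ P, ∀ q ∈ P, JoinedIn P p q := by
    rintro ⟨x₁, y₁⟩ h₁ ⟨x₂, y₂⟩ h₂
    have hm : 0 < min x₁ x₂ := lt_min (hpos _ h₁) (hpos _ h₂)
    have hm₁ := hleft h₁ hm (min_le_left _ _)
    have hm₂ := hleft h₂ hm (min_le_right _ _)
    have joined_middle : JoinedIn P (min x₁ x₂, y₁) (min x₁ x₂, y₂) := by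
      rcases le_total y₁ y₂ with hle | hle
      · exact joined_up hm₁ hm₂ hle
      · exact (joined_up hm₂ hm₁ hle).symm
    exact ((joined_left h₁ hm (min_le_left _ _)).trans joined_middle).trans
      (joined_left h₂ hm (min_le_right _ _)).symm
  rcases P.eq_empty_or_nonempty with rfl | ⟨p, hp⟩
  · exact isPreconnected_empty
  · exact (IsPathConnected.isConnected ⟨p, hp, fun {q} hq => joined p hp q hq⟩).isPreconnected

/-- The quarter of the open disc of radius `r` about the origin that lies in the open first
quadrant. It models the square near a corner. -/
def quarterDisc (r : ℝ) : Set (ℝ × ℝ) := {q | 0 < q.1 ∧ 0 < q.2 ∧ q.1 ^ 2 + q.2 ^ 2 < r ^ 2}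

variable {r : ℝ} {f : ℝ × ℝ → ℝ} {w : ℝ → ℝ}

theorem mem_quarterDisc_of_le {x y x' y' : ℝ} (h : (x, y) ∈ quarterDisc r) (hx' : 0 < x')
    (hy' : 0 < y') (hx : x' ≤ x) (hy : y' ≤ y) : (x', y') ∈ quarterDisc r :=
  ⟨hx', hy', (by gcongr : x' ^ 2 + y' ^ 2 ≤ x ^ 2 + y ^ 2).trans_lt h.2.2⟩

theorem swap_mem_quarterDisc {q : ℝ × ℝ} : q.swap ∈ quarterDisc r ↔ q ∈ quarterDisc r := by
  simp only [quarterDisc, mem_ofPred_eq, Prod.fst_swap, Prod.snd_swap, add_comm, and_left_comm]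

theorem isPreconnected_quarterDisc_pos (hw : ∀ t, 0 < w t)
    (hx : ∀ y, AntitoneOn (fun x => w x * f (x, y)) {x | (x, y) ∈ quarterDisc r})
    (hy : ∀ x, MonotoneOn (fun y => w y * f (x, y)) {y | (x, y) ∈ quarterDisc r}) :
    IsPreconnected {q ∈ quarterDisc r | 0 < f q} := by
  refine isPreconnected_of_left_mem_of_vertical_mem (fun q hq => hq.1.1) ?_ ?_
  · rintro x x' y ⟨hq, hf⟩ hx' hle
    have hq' := mem_quarterDisc_of_le hq hx' hq.2.1 hle le_rfl
    exact ⟨hq', pos_of_mul_pos_right ((mul_pos (hw x) hf).trans_le (hx y hq' hq hle)) (hw x').le⟩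
  · rintro x y₁ y y₂ ⟨hq₁, hf₁⟩ ⟨hq₂, -⟩ ⟨h₁, h₂⟩
    have hq := mem_quarterDisc_of_le hq₂ hq₂.1 (hq₁.2.1.trans_le h₁) le_rfl h₂
    exact ⟨hq, pos_of_mul_pos_right ((mul_pos (hw y₁) hf₁).trans_le (hy x hq₁ hq h₁)) (hw y).le⟩

theorem isPreconnected_quarterDisc_neg (hw : ∀ t, 0 < w t)
    (hx : ∀ y, AntitoneOn (fun x => w x * f (x, y)) {x | (x, y) ∈ quarterDisc r})
    (hy : ∀ x, MonotoneOn (fun y => w y * f (x, y)) {y | (x, y) ∈ quarterDisc r}) :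
    IsPreconnected {q ∈ quarterDisc r | f q < 0} := by
  have hswap : IsPreconnected {q ∈ quarterDisc r | 0 < -f q.swap} := by
    refine isPreconnected_quarterDisc_pos hw (fun y => ?_) (fun x => ?_)
    · simpa only [mul_neg, Prod.swap_prod_mk, ← swap_mem_quarterDisc (q := (_, y))] using (hy y).neg
    · simpa only [mul_neg, Prod.swap_prod_mk, ← swap_mem_quarterDisc (q := (x, _))] using (hx x).neg
  convert hswap.image Prod.swap continuous_swap.continuousOn using 1
  rw [image_swap_eq_preimage_swap]
  ext q
  simp [swap_mem_quarterDisc]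

theorem ncard_nodalDomains_image_quarterDisc {J : ℝ × ℝ → Plane} {u : Plane → ℝ}
    (hJ : Continuous J) (hu : ContinuousOn u (J '' quarterDisc r)) (hw : ∀ t, 0 < w t)
    (hx : ∀ y, AntitoneOn (fun x => w x * u (J (x, y))) {x | (x, y) ∈ quarterDisc r})
    (hy : ∀ x, MonotoneOn (fun y => w y * u (J (x, y))) {y | (x, y) ∈ quarterDisc r})
    (hpos : ∃ z ∈ J '' quarterDisc r, 0 < u z) (hneg : ∃ z ∈ J '' quarterDisc r, u z < 0) :
    (nodalDomains u (J '' quarterDisc r)).ncard = 2 := by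
  have image_sep : ∀ p : ℝ → Prop,
      {z ∈ J '' quarterDisc r | p (u z)} = J '' {q ∈ quarterDisc r | p (u (J q))} :=
    fun p => (image_inter_preimage J (quarterDisc r) {z | p (u z)}).symm
  refine ncard_nodalDomains_eq_two hu ⟨hpos, ?_⟩ ⟨hneg, ?_⟩
  · rw [image_sep (0 < ·)]
    exact (isPreconnected_quarterDisc_pos hw hx hy).image J hJ.continuousOn
  · rw [image_sep (· < 0)]
    exact (isPreconnected_quarterDisc_neg hw hx hy).image J hJ.continuousOn

end QuarterDisc

section Monotonicity

variable {u u' u'' : ℝ → ℝ} {h T : ℝ}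

theorem strictAntiOn_exp_mul
    (hu : ∀ t ∈ Icc 0 T, HasDerivWithinAt u (u' t) (Icc 0 T) t)
    (hu' : ∀ t ∈ Icc 0 T, HasDerivWithinAt u' (u'' t) (Icc 0 T) t)
    (h0 : u' 0 ≤ h * u 0) (hneg : ∀ t ∈ Ioo 0 T, u'' t < h * u' t) :
    StrictAntiOn (fun t => Real.exp (-h * t) * u t) (Icc 0 T) := by
  have flux_anti : StrictAntiOn (fun t => u' t - h * u t) (Icc 0 T) := by
    refine strictAntiOn_of_deriv_neg (convex_Icc _ _) (fun t ht =>
      ((hu' t ht).sub ((hu t ht).const_mul h)).continuousWithinAt) fun t ht => ?_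
    rw [interior_Icc] at ht
    have ht' := Ioo_subset_Icc_self ht
    have hderiv := ((hu' t ht').sub ((hu t ht').const_mul h)).hasDerivAt (Icc_mem_nhds ht.1 ht.2)
    exact hderiv.deriv.trans_lt (sub_neg.2 (hneg t ht))
  have hexp : ∀ t, HasDerivAt (fun t => Real.exp (-h * t)) (Real.exp (-h * t) * -h) t := fun t => by
    simpa using ((hasDerivAt_id t).const_mul (-h)).exp
  refine strictAntiOn_of_deriv_neg (convex_Icc _ _) (fun t ht =>
    ((hexp t).hasDerivWithinAt.mul (hu t ht)).continuousWithinAt) fun t ht => ?_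
  rw [interior_Icc] at ht
  have ht' := Ioo_subset_Icc_self ht
  have hderiv := (hexp t).mul ((hu t ht').hasDerivAt (Icc_mem_nhds ht.1 ht.2))
  have flux_neg : u' t - h * u t < 0 :=
    (flux_anti (left_mem_Icc.2 (ht.1.trans ht.2).le) ht' ht.1).trans_le (sub_nonpos.2 h0)
  calc deriv _ t = Real.exp (-h * t) * (u' t - h * u t) := hderiv.deriv.trans (by ring)
    _ < 0 := mul_neg_of_pos_of_neg (Real.exp_pos _) flux_neg

end Monotonicity

section DirDeriv

variable {E : Type*} [NormedAddCommGroup E] [NormedSpace ℝ E] {S : Set E} {u : E → ℝ} {z v : E}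

/-- The derivative of `u` at `z` in the direction `v`, taken within `S`. Iterating it expresses
second derivatives at boundary points. -/
noncomputable def dirDeriv (S : Set E) (v : E) (u : E → ℝ) (z : E) : ℝ := fderivWithin ℝ u S z v

theorem dirDeriv_neg_direction (S : Set E) (v : E) (u : E → ℝ) (z : E) :
    dirDeriv S (-v) u z = -dirDeriv S v u z :=
  map_neg _ v

theorem dirDeriv_neg (hS : UniqueDiffOn ℝ S) (hz : z ∈ S) :
    dirDeriv S v (-u) z = -dirDeriv S v u z := by
  rw [dirDeriv, fderivWithin_neg (hS z hz)]
  rfl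

theorem dirDeriv_dirDeriv_neg (hS : UniqueDiffOn ℝ S) (hz : z ∈ S) :
    dirDeriv S v (dirDeriv S v (-u)) z = -dirDeriv S v (dirDeriv S v u) z := by
  have hfirst : ∀ w ∈ S, dirDeriv S v (-u) w = (-dirDeriv S v u) w := fun w hw =>
    dirDeriv_neg hS hw
  rw [← dirDeriv_neg hS hz, dirDeriv, fderivWithin_congr' hfirst hz, dirDeriv]

theorem dirDeriv_dirDeriv_neg_direction (hS : UniqueDiffOn ℝ S) (hz : z ∈ S) :
    dirDeriv S (-v) (dirDeriv S (-v) u) z = dirDeriv S v (dirDeriv S v u) z := by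
  have hfirst : dirDeriv S (-v) u = -dirDeriv S v u := funext (dirDeriv_neg_direction S v u)
  rw [dirDeriv_neg_direction, hfirst, dirDeriv_neg hS hz, neg_neg]

theorem contDiffWithinAt_uncurry_dirDeriv {T : Type*} [NormedAddCommGroup T] [NormedSpace ℝ T]
    {A : Set T} {u : T → E → ℝ} {τ : T} {m n : ℕ∞ω} (hS : UniqueDiffOn ℝ S) (hz : z ∈ S)
    (hτ : τ ∈ A) (hu : ContDiffWithinAt ℝ n (fun p : E × T => u p.2 p.1) (S ×ˢ A) (z, τ))
    (hmn : m + 1 ≤ n) (v : E) :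
    ContDiffWithinAt ℝ m (fun p : E × T => dirDeriv S v (u p.2) p.1) (S ×ˢ A) (z, τ) := by
  refine ContDiffWithinAt.fderivWithin_apply (f := fun p : E × T => u p.2) ?_
    contDiffWithinAt_fst contDiffWithinAt_const hS hmn ⟨hz, hτ⟩ fun p hp => hp.1
  exact hu.comp (f := fun q : (E × T) × E => (q.2, q.1.2)) ((z, τ), z) (by fun_prop)
    fun q hq => ⟨hq.2, hq.1.2⟩

theorem contDiffWithinAt_dirDeriv {m n : ℕ∞ω} (hS : UniqueDiffOn ℝ S) (hz : z ∈ S)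
    (hu : ContDiffWithinAt ℝ n u S z) (hmn : m + 1 ≤ n) (v : E) :
    ContDiffWithinAt ℝ m (dirDeriv S v u) S z :=
  hu.fderivWithin_right_apply contDiffWithinAt_const hS hmn hz

theorem differentiableWithinAt_dirDeriv (hS : UniqueDiffOn ℝ S) (hz : z ∈ S)
    (hu : ContDiffWithinAt ℝ 2 u S z) (v : E) : DifferentiableWithinAt ℝ (dirDeriv S v u) S z :=
  (contDiffWithinAt_dirDeriv (m := 1) hS hz hu (by norm_num) v).differentiableWithinAt one_ne_zero

theorem iteratedFDerivWithin_two_eq_dirDeriv (hS : UniqueDiffOn ℝ S) (hz : z ∈ S)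
    (hu : ContDiffWithinAt ℝ 2 u S z) (v w : E) :
    iteratedFDerivWithin ℝ 2 u S z ![v, w] = dirDeriv S v (dirDeriv S w u) z := by
  have hdiff : DifferentiableWithinAt ℝ (fderivWithin ℝ u S) S z :=
    (hu.fderivWithin_right (m := 1) hS (by norm_num) hz).differentiableWithinAt (by norm_num)
  have hsecond := fderivWithin_clm_apply (hS z hz) hdiff (differentiableWithinAt_const w)
  rw [iteratedFDerivWithin_two_apply _ hS hz]
  change _ = fderivWithin ℝ (fun y => fderivWithin ℝ u S y w) S z v
  simp [hsecond]

theorem hasDerivWithinAt_line {p v : E} {I : Set ℝ} {t : ℝ} (hmaps : MapsTo (p + · • v) I S)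
    (hu : DifferentiableWithinAt ℝ u S (p + t • v)) :
    HasDerivWithinAt (fun t => u (p + t • v)) (dirDeriv S v u (p + t • v)) I t := by
  have hline : HasDerivWithinAt (p + · • v) v I t := by
    simpa using (((hasDerivAt_id t).smul_const v).const_add p).hasDerivWithinAt
  exact hu.hasFDerivWithinAt.comp_hasDerivWithinAt t hline hmaps

theorem strictAntiOn_exp_mul_line {p v : E} {h T : ℝ} (hS : UniqueDiffOn ℝ S)
    (hmaps : MapsTo (p + · • v) (Icc 0 T) S)
    (hu : ∀ t ∈ Icc 0 T, ContDiffWithinAt ℝ 2 u S (p + t • v))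
    (h0 : dirDeriv S v u p ≤ h * u p)
    (hneg : ∀ t ∈ Icc 0 T,
      dirDeriv S v (dirDeriv S v u) (p + t • v) < h * dirDeriv S v u (p + t • v)) :
    StrictAntiOn (fun t => Real.exp (-h * t) * u (p + t • v)) (Icc 0 T) :=
  strictAntiOn_exp_mul
    (fun t ht => hasDerivWithinAt_line hmaps ((hu t ht).differentiableWithinAt (by norm_num)))
    (fun t ht => hasDerivWithinAt_line hmaps
      (differentiableWithinAt_dirDeriv hS (hmaps ht) (hu t ht) v))
    (by simpa using h0) fun t ht => hneg t (Ioo_subset_Icc_self ht)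

end DirDeriv

section Square

theorem square_eq_preimage : square =
    (EuclideanSpace.equiv (Fin 2) ℝ) ⁻¹' univ.pi fun _ => Ioo (-(Real.pi / 2)) (Real.pi / 2) := by
  ext z
  simp [square, abs_lt]

theorem closedSquare_eq_preimage : closedSquare =
    (EuclideanSpace.equiv (Fin 2) ℝ) ⁻¹' univ.pi fun _ => Icc (-(Real.pi / 2)) (Real.pi / 2) := by
  ext z
  simp [closedSquare, abs_le, -pi_univ_Icc]

theorem closure_square : closure square = closedSquare := by
  have hne : -(Real.pi / 2) ≠ Real.pi / 2 := by linarith [Real.pi_pos]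
  rw [square_eq_preimage, closedSquare_eq_preimage,
    ← (EuclideanSpace.equiv (Fin 2) ℝ).preimage_closure, closure_pi_set]
  simp only [closure_Ioo hne]

theorem isOpen_square : IsOpen square := by
  rw [square_eq_preimage]
  exact (isOpen_set_pi finite_univ fun _ _ => isOpen_Ioo).preimage
    (EuclideanSpace.equiv (Fin 2) ℝ).continuous

theorem square_subset_closedSquare : square ⊆ closedSquare :=
  closure_square ▸ subset_closure

theorem uniqueDiffOn_closedSquare : UniqueDiffOn ℝ closedSquare := by
  rw [closedSquare_eq_preimage, ContinuousLinearEquiv.uniqueDiffOn_preimage_iff]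
  exact UniqueDiffOn.univ_pi fun _ => uniqueDiffOn_Icc (by linarith [Real.pi_pos])

theorem closedSquare_inter_subset_closure {U : Set Plane} (hU : IsOpen U) :
    closedSquare ∩ U ⊆ closure (U ∩ square) := by
  rw [← closure_square, inter_comm]
  exact hU.inter_closure

theorem IsCorner.mem_closedSquare {z₀ : Plane} (hz₀ : IsCorner z₀) : z₀ ∈ closedSquare :=
  fun i => (hz₀ i).le

theorem IsOutwardNormal.mem_closedSquare {z ν : Plane} (hν : IsOutwardNormal z ν) :
    z ∈ closedSquare := by
  obtain ⟨i, s, hs, hi, hlt, -⟩ := hν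
  intro k
  rcases eq_or_ne k i with rfl | hk
  · rcases hs with rfl | rfl <;> simp [hi, abs_of_pos Real.pi_div_two_pos]
  · exact (hlt k hk).le

theorem exists_mem_of_subset_closure {X Y : Type*} [TopologicalSpace X] [TopologicalSpace Y]
    {f : X → Y} {s t : Set X} {V : Set Y} {x : X} (hf : ContinuousOn f t) (hst : s ⊆ t)
    (hts : t ⊆ closure s) (hx : x ∈ t) (hV : IsOpen V) (hfx : f x ∈ V) : ∃ y ∈ s, f y ∈ V := by
  have := mem_closure_iff_nhdsWithin_neBot.1 (hts hx)
  have hnear : ∀ᶠ y in 𝓝[s] x, f y ∈ V :=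
    ((hf x hx).mono hst).eventually_mem (hV.mem_nhds hfx)
  exact (eventually_mem_nhdsWithin.and hnear).exists

end Square

section CornerChart

variable {z₀ : Plane} {i j : Fin 2} {q : ℝ × ℝ} {r : ℝ}

/-- For a corner `z₀`, the inward-pointing unit normal of the side of the square on which the
`i`-th coordinate is constant and equal to `z₀ i`. -/
noncomputable def inwardNormal (z₀ : Plane) (i : Fin 2) : Plane :=
  -(z₀ i / (Real.pi / 2)) • EuclideanSpace.single i 1

/-- Coordinates at the corner `z₀` measuring the distances to the two sides that meet there:
`q.1` is the distance along axis `i` and `q.2` the distance along axis `j`. Keeping the axes as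
parameters allows either of the two orders. -/
noncomputable def cornerChart (z₀ : Plane) (i j : Fin 2) (q : ℝ × ℝ) : Plane :=
  z₀ + q.2 • inwardNormal z₀ j + q.1 • inwardNormal z₀ i

theorem cornerChart_zero (z₀ : Plane) (i j : Fin 2) : cornerChart z₀ i j 0 = z₀ := by
  simp [cornerChart]

theorem cornerChart_swap (z₀ : Plane) (i j : Fin 2) (q : ℝ × ℝ) :
    cornerChart z₀ i j q.swap = cornerChart z₀ j i q :=
  add_right_comm _ _ _

theorem continuous_cornerChart (z₀ : Plane) (i j : Fin 2) : Continuous (cornerChart z₀ i j) := by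
  unfold cornerChart
  fun_prop

theorem forall_fin_two_of_ne (hij : i ≠ j) {p : Fin 2 → Prop} : (∀ k, p k) ↔ p i ∧ p j := by
  fin_cases i <;> fin_cases j <;> simp_all [Fin.forall_fin_two, and_comm]

theorem cornerChart_apply_left (hij : i ≠ j) :
    cornerChart z₀ i j q i = z₀ i * (1 - q.1 / (Real.pi / 2)) := by
  simp only [cornerChart, inwardNormal, neg_smul, smul_neg, PiLp.add_apply, PiLp.neg_apply,
    PiLp.smul_apply, ne_eq, hij, not_false_eq_true, PiLp.single_eq_of_ne, PiLp.single_eq_same,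
    smul_eq_mul, mul_zero, mul_one, neg_zero, add_zero]
  ring

theorem cornerChart_apply_right (hij : i ≠ j) :
    cornerChart z₀ i j q j = z₀ j * (1 - q.2 / (Real.pi / 2)) := by
  rw [← cornerChart_swap, cornerChart_apply_left hij.symm, Prod.fst_swap]

theorem IsCorner.abs_mul_one_sub_div (hz₀ : IsCorner z₀) (i : Fin 2) (t : ℝ) :
    |z₀ i * (1 - t / (Real.pi / 2))| = |Real.pi / 2 - t| := by
  rw [abs_mul, hz₀ i, ← abs_of_pos Real.pi_div_two_pos, ← abs_mul,
    abs_of_pos Real.pi_div_two_pos, mul_sub, mul_one, mul_div_cancel₀ _ Real.pi_div_two_pos.ne']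

theorem cornerChart_mem_square (hz₀ : IsCorner z₀) (hij : i ≠ j) :
    cornerChart z₀ i j q ∈ square ↔ q.1 ∈ Ioo 0 Real.pi ∧ q.2 ∈ Ioo 0 Real.pi := by
  rw [square, mem_ofPred_eq, forall_fin_two_of_ne hij, cornerChart_apply_left hij,
    cornerChart_apply_right hij, hz₀.abs_mul_one_sub_div, hz₀.abs_mul_one_sub_div]
  simp only [abs_lt, mem_Ioo]
  grind

theorem cornerChart_mem_closedSquare (hz₀ : IsCorner z₀) (hij : i ≠ j) :
    cornerChart z₀ i j q ∈ closedSquare ↔ q.1 ∈ Icc 0 Real.pi ∧ q.2 ∈ Icc 0 Real.pi := by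
  rw [closedSquare, mem_ofPred_eq, forall_fin_two_of_ne hij, cornerChart_apply_left hij,
    cornerChart_apply_right hij, hz₀.abs_mul_one_sub_div, hz₀.abs_mul_one_sub_div]
  simp only [abs_le, mem_Icc]
  grind

theorem cornerChart_mem_ball (hz₀ : IsCorner z₀) (hij : i ≠ j) (hr : 0 < r) :
    cornerChart z₀ i j q ∈ Metric.ball z₀ r ↔ q.1 ^ 2 + q.2 ^ 2 < r ^ 2 := by
  have hn : ∀ k, ‖inwardNormal z₀ k‖ = 1 := fun k => by
    rw [inwardNormal, norm_smul, PiLp.norm_single, norm_one, mul_one, norm_neg, norm_div,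
      Real.norm_eq_abs, hz₀ k, Real.norm_of_nonneg Real.pi_div_two_pos.le,
      div_self Real.pi_div_two_pos.ne']
  have horth : inner ℝ (q.2 • inwardNormal z₀ j) (q.1 • inwardNormal z₀ i) = 0 := by
    simp [inwardNormal, inner_smul_left, inner_smul_right,
      EuclideanSpace.inner_single_left, hij.symm]
  have hdist : dist (cornerChart z₀ i j q) z₀ ^ 2 = q.1 ^ 2 + q.2 ^ 2 := by
    rw [dist_eq_norm, cornerChart, add_assoc, add_sub_cancel_left, sq,
      norm_add_sq_eq_norm_sq_add_norm_sq_real horth]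
    simp only [norm_smul, hn, mul_one, Real.norm_eq_abs, abs_mul_abs_self]
    ring
  rw [Metric.mem_ball, ← hdist, pow_lt_pow_iff_left₀ dist_nonneg hr.le two_ne_zero]

theorem surjective_cornerChart (hz₀ : IsCorner z₀) (hij : i ≠ j) :
    Function.Surjective (cornerChart z₀ i j) := by
  have hne : ∀ k, z₀ k ≠ 0 := fun k h =>
    Real.pi_div_two_pos.ne (by rw [← hz₀ k, h, abs_zero])
  have hπ := Real.pi_ne_zero
  intro z
  refine ⟨(Real.pi / 2 * (1 - z i / z₀ i), Real.pi / 2 * (1 - z j / z₀ j)), ?_⟩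
  rw [PiLp.ext_iff, forall_fin_two_of_ne hij, cornerChart_apply_left hij,
    cornerChart_apply_right hij]
  have := hne i
  have := hne j
  constructor <;> field_simp <;> ring

theorem image_cornerChart_quarterDisc (hz₀ : IsCorner z₀) (hij : i ≠ j) (hr : 0 < r)
    (hrπ : r ≤ Real.pi) : cornerChart z₀ i j '' quarterDisc r = Metric.ball z₀ r ∩ square := by
  have hmem : ∀ q, q ∈ quarterDisc r ↔ cornerChart z₀ i j q ∈ Metric.ball z₀ r ∩ square := by
    intro q
    rw [mem_inter_iff, cornerChart_mem_ball hz₀ hij hr, cornerChart_mem_square hz₀ hij]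
    refine ⟨fun ⟨h₁, h₂, h⟩ => ⟨h, ⟨h₁, ?_⟩, h₂, ?_⟩, fun ⟨h, h₁, h₂⟩ => ⟨h₁.1, h₂.1, h⟩⟩
    · exact (lt_of_pow_lt_pow_left₀ 2 hr.le (by nlinarith)).trans_le hrπ
    · exact (lt_of_pow_lt_pow_left₀ 2 hr.le (by nlinarith)).trans_le hrπ
  refine Subset.antisymm (image_subset_iff.2 fun q hq => (hmem q).1 hq) fun z hz => ?_
  obtain ⟨q, rfl⟩ := surjective_cornerChart hz₀ hij z
  exact ⟨q, (hmem q).2 hz, rfl⟩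

theorem isOutwardNormal_cornerChart (hz₀ : IsCorner z₀) (hij : i ≠ j) {y : ℝ}
    (hy : y ∈ Ioo 0 Real.pi) :
    IsOutwardNormal (cornerChart z₀ i j (0, y)) (-inwardNormal z₀ i) := by
  have hπ := Real.pi_div_two_pos.ne'
  refine ⟨i, z₀ i / (Real.pi / 2), ?_, ?_, fun k hk => ?_, ?_⟩
  · rw [div_eq_one_iff_eq hπ, div_eq_iff hπ, neg_one_mul]
    exact eq_or_eq_neg_of_abs_eq (hz₀ i)
  · simp [cornerChart_apply_left hij, div_mul_cancel₀ _ hπ]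
  · obtain rfl : k = j := by lia
    rw [cornerChart_apply_right hij, hz₀.abs_mul_one_sub_div, abs_lt]
    constructor <;> linarith [hy.1, hy.2]
  · rw [inwardNormal, neg_smul, neg_neg]

end CornerChart

section RobinCorner

variable {z₀ : Plane} {i j : Fin 2} {r h : ℝ} {U : Set Plane} {u : Plane → ℝ}

/-- `u` is twice continuously differentiable on the part of the closed square in `U`, up to the
boundary, and satisfies the Robin condition with parameter `h` on the part of the open sides
in `U`. -/
structure IsRobinOn (h : ℝ) (U : Set Plane) (u : Plane → ℝ) : Prop where
  contDiffWithinAt : ∀ z ∈ closedSquare ∩ U, ContDiffWithinAt ℝ 2 u closedSquare z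
  robin : ∀ z ∈ U, ∀ ν, IsOutwardNormal z ν → fderivWithin ℝ u closedSquare z ν + h * u z = 0

/-- On the part of the closed square in `U`, the function `∂u/∂v - h u` has negative derivative in
the direction `v`. If `v` is the inward normal of a side, then `-(∂u/∂v - h u)` is the left-hand
side of the Robin condition. -/
def HasDecreasingFlux (h : ℝ) (v : Plane) (U : Set Plane) (u : Plane → ℝ) : Prop :=
  ∀ z ∈ closedSquare ∩ U,
    dirDeriv closedSquare v (dirDeriv closedSquare v u) z < h * dirDeriv closedSquare v u z

namespace IsRobinOn

theorem mono {V : Set Plane} (hu : IsRobinOn h U u) (hVU : V ⊆ U) : IsRobinOn h V u where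
  contDiffWithinAt z hz := hu.contDiffWithinAt z ⟨hz.1, hVU hz.2⟩
  robin z hz := hu.robin z (hVU hz)

theorem continuousOn (hu : IsRobinOn h U u) : ContinuousOn u (closedSquare ∩ U) := fun z hz =>
  (hu.contDiffWithinAt z hz).continuousWithinAt.mono inter_subset_left

theorem continuousOn_dirDeriv (hu : IsRobinOn h U u) (v : Plane) :
    ContinuousOn (dirDeriv closedSquare v u) (closedSquare ∩ U) := fun z hz =>
  (differentiableWithinAt_dirDeriv uniqueDiffOn_closedSquare hz.1 (hu.contDiffWithinAt z hz)
    v).continuousWithinAt.mono inter_subset_left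

theorem neg (hu : IsRobinOn h U u) : IsRobinOn h U (-u) where
  contDiffWithinAt z hz := (hu.contDiffWithinAt z hz).neg
  robin z hz ν hν := by
    have hrobin := hu.robin z hz ν hν
    rw [fderivWithin_neg (uniqueDiffOn_closedSquare z hν.mem_closedSquare), _root_.neg_apply,
      Pi.neg_apply]
    linarith

theorem dirDeriv_inwardNormal (hz₀ : IsCorner z₀) (hij : i ≠ j) (hr : 0 < r) (hrπ : r ≤ Real.pi)
    (hu : IsRobinOn h (Metric.ball z₀ r) u) {y : ℝ} (hy : y ∈ Ico 0 r) :
    dirDeriv closedSquare (inwardNormal z₀ i) u (cornerChart z₀ i j (0, y)) =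
      h * u (cornerChart z₀ i j (0, y)) := by
  have hball : ∀ t ∈ Ico 0 r, cornerChart z₀ i j (0, t) ∈ Metric.ball z₀ r := fun t ht => by
    rw [cornerChart_mem_ball hz₀ hij hr]
    simpa using pow_lt_pow_left₀ ht.2 ht.1 two_ne_zero
  have hmaps : MapsTo (fun t => cornerChart z₀ i j (0, t)) (Ico 0 r)
      (closedSquare ∩ Metric.ball z₀ r) := fun t ht =>
    ⟨(cornerChart_mem_closedSquare hz₀ hij).2
      ⟨⟨le_rfl, Real.pi_nonneg⟩, ht.1, ht.2.le.trans hrπ⟩, hball t ht⟩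
  have hcont : Continuous fun t : ℝ => cornerChart z₀ i j (0, t) :=
    (continuous_cornerChart z₀ i j).comp (by fun_prop)
  have open_side : EqOn (fun t => dirDeriv closedSquare (inwardNormal z₀ i) u
      (cornerChart z₀ i j (0, t))) (fun t => h * u (cornerChart z₀ i j (0, t))) (Ioo 0 r) := by
    intro t ht
    have hrobin := hu.robin _ (hball t (Ioo_subset_Ico_self ht)) _
      (isOutwardNormal_cornerChart hz₀ hij ⟨ht.1, ht.2.trans_le hrπ⟩)
    rw [map_neg, neg_add_eq_zero] at hrobin
    exact hrobin
  exact open_side.of_subset_closure ((hu.continuousOn_dirDeriv _).comp hcont.continuousOn hmaps)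
    ((hu.continuousOn.comp hcont.continuousOn hmaps).const_mul h) Ioo_subset_Ico_self
    (closure_Ioo hr.ne ▸ Ico_subset_Icc_self) hy

theorem dirDeriv_inwardNormal_corner (hz₀ : IsCorner z₀) (hr : 0 < r)
    (hu : IsRobinOn h (Metric.ball z₀ r) u) (i : Fin 2) :
    dirDeriv closedSquare (inwardNormal z₀ i) u z₀ = h * u z₀ := by
  obtain ⟨j, hji⟩ := exists_ne i
  have hmin := lt_min hr Real.pi_pos
  have hside := (hu.mono (Metric.ball_subset_ball (min_le_left r Real.pi))).dirDeriv_inwardNormal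
    hz₀ hji.symm hmin (min_le_right _ _) (left_mem_Ico.2 hmin)
  rwa [show cornerChart z₀ i j (0, 0) = z₀ from cornerChart_zero z₀ i j] at hside

end IsRobinOn

theorem HasDecreasingFlux.mono {v : Plane} {V : Set Plane} (hu : HasDecreasingFlux h v U u)
    (hVU : V ⊆ U) : HasDecreasingFlux h v V u :=
  fun z hz => hu z ⟨hz.1, hVU hz.2⟩

theorem strictAntiOn_cornerChart (hz₀ : IsCorner z₀) (hij : i ≠ j) (hr : 0 < r)
    (hrπ : r ≤ Real.pi) (hu : IsRobinOn h (Metric.ball z₀ r) u)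
    (hflux : HasDecreasingFlux h (inwardNormal z₀ i) (Metric.ball z₀ r) u) {y T : ℝ} (hy : 0 ≤ y)
    (hTy : T ^ 2 + y ^ 2 < r ^ 2) :
    StrictAntiOn (fun t => Real.exp (-h * t) * u (cornerChart z₀ i j (t, y))) (Icc 0 T) := by
  have hyr : y < r := lt_of_pow_lt_pow_left₀ 2 hr.le (by nlinarith)
  have hmaps : MapsTo (fun t => cornerChart z₀ i j (t, y)) (Icc 0 T)
      (closedSquare ∩ Metric.ball z₀ r) := fun t ht => by
    have htT : t ^ 2 ≤ T ^ 2 := pow_le_pow_left₀ ht.1 ht.2 2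
    have ht_lt : t < r := lt_of_pow_lt_pow_left₀ 2 hr.le (by nlinarith)
    exact ⟨(cornerChart_mem_closedSquare hz₀ hij).2
      ⟨⟨ht.1, ht_lt.le.trans hrπ⟩, hy, hyr.le.trans hrπ⟩,
      (cornerChart_mem_ball hz₀ hij hr).2 (by linarith)⟩
  have hside := hu.dirDeriv_inwardNormal hz₀ hij hr hrπ ⟨hy, hyr⟩
  simp only [cornerChart, zero_smul, add_zero] at hside
  exact strictAntiOn_exp_mul_line uniqueDiffOn_closedSquare (fun t ht => (hmaps ht).1)
    (fun t ht => hu.contDiffWithinAt _ (hmaps ht)) hside.le fun t ht => hflux _ (hmaps ht)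

theorem strictMonoOn_cornerChart (hz₀ : IsCorner z₀) (hij : i ≠ j) (hr : 0 < r)
    (hrπ : r ≤ Real.pi) (hu : IsRobinOn h (Metric.ball z₀ r) u)
    (hflux : HasDecreasingFlux h (inwardNormal z₀ j) (Metric.ball z₀ r) (-u)) {x T : ℝ} (hx : 0 ≤ x)
    (hTx : T ^ 2 + x ^ 2 < r ^ 2) :
    StrictMonoOn (fun t => Real.exp (-h * t) * u (cornerChart z₀ i j (x, t))) (Icc 0 T) := by
  intro a ha b hb hab
  have hlt := strictAntiOn_cornerChart hz₀ hij.symm hr hrπ hu.neg hflux hx hTx ha hb hab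
  simpa only [← cornerChart_swap z₀ i j, Prod.swap_prod_mk, Pi.neg_apply, mul_neg, neg_lt_neg_iff]
    using hlt

theorem ncard_nodalDomains_corner (hz₀ : IsCorner z₀) (hij : i ≠ j) (hr : 0 < r)
    (hrπ : r ≤ Real.pi) (hu : IsRobinOn h (Metric.ball z₀ r) u)
    (hi : HasDecreasingFlux h (inwardNormal z₀ i) (Metric.ball z₀ r) u)
    (hj : HasDecreasingFlux h (inwardNormal z₀ j) (Metric.ball z₀ r) (-u))
    (hpos : ∃ z ∈ Metric.ball z₀ r ∩ square, 0 < u z)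
    (hneg : ∃ z ∈ Metric.ball z₀ r ∩ square, u z < 0) :
    (nodalDomains u (Metric.ball z₀ r ∩ square)).ncard = 2 := by
  have hcont : ContinuousOn u (Metric.ball z₀ r ∩ square) :=
    hu.continuousOn.mono fun z hz => ⟨square_subset_closedSquare hz.2, hz.1⟩
  rw [← image_cornerChart_quarterDisc hz₀ hij hr hrπ] at hpos hneg hcont ⊢
  refine ncard_nodalDomains_image_quarterDisc (w := fun t => Real.exp (-h * t))
    (continuous_cornerChart z₀ i j) hcont (fun t => Real.exp_pos _) ?_ ?_ hpos hneg
  · intro y x ⟨hx, hy, _⟩ x' ⟨_, _, hx'y⟩ hle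
    exact (strictAntiOn_cornerChart hz₀ hij hr hrπ hu hi hy.le hx'y).antitoneOn
      ⟨hx.le, hle⟩ (right_mem_Icc.2 (hx.le.trans hle)) hle
  · intro x y ⟨hx, hy, _⟩ y' ⟨_, _, hxy'⟩ hle
    exact (strictMonoOn_cornerChart hz₀ hij hr hrπ hu hj hx.le
      ((add_comm _ _).trans_lt hxy')).monotoneOn
      ⟨hy.le, hle⟩ (right_mem_Icc.2 (hy.le.trans hle)) hle

theorem exists_neg_of_hasDecreasingFlux (hz₀ : IsCorner z₀) (hr : 0 < r)
    (hrπ : r ≤ Real.pi) (hu : IsRobinOn h (Metric.ball z₀ r) u)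
    (hflux : HasDecreasingFlux h (inwardNormal z₀ i) (Metric.ball z₀ r) u) (hzero : u z₀ = 0) :
    ∃ z ∈ Metric.ball z₀ r ∩ square, u z < 0 := by
  obtain ⟨j, hji⟩ := exists_ne i
  have hanti := strictAntiOn_cornerChart hz₀ hji.symm hr hrπ hu hflux (T := r / 2) le_rfl
    (by nlinarith) (left_mem_Icc.2 (half_pos hr).le) (right_mem_Icc.2 (half_pos hr).le)
    (half_pos hr)
  have haxis : u (cornerChart z₀ i j (r / 2, 0)) < 0 := by
    have hcorner : cornerChart z₀ i j (0, 0) = z₀ := cornerChart_zero z₀ i j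
    simp only [hcorner, hzero, mul_zero] at hanti
    exact neg_of_mul_neg_right hanti (Real.exp_pos _).le
  have hmem : cornerChart z₀ i j (r / 2, 0) ∈ closedSquare ∩ Metric.ball z₀ r :=
    ⟨(cornerChart_mem_closedSquare hz₀ hji.symm).2
      ⟨⟨(half_pos hr).le, by linarith⟩, le_rfl, Real.pi_nonneg⟩,
      (cornerChart_mem_ball hz₀ hji.symm hr).2 (by nlinarith)⟩
  exact exists_mem_of_subset_closure hu.continuousOn
    (fun z hz => ⟨square_subset_closedSquare hz.2, hz.1⟩)
    (closedSquare_inter_subset_closure Metric.isOpen_ball) hmem isOpen_Iio haxis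

end RobinCorner

section Laplacian

variable {z₀ z : Plane} {U : Set Plane} {u : Plane → ℝ} {lam : ℝ}

theorem dirDeriv_dirDeriv_inwardNormal (hz₀ : IsCorner z₀) (i : Fin 2) (hz : z ∈ closedSquare) :
    dirDeriv closedSquare (inwardNormal z₀ i) (dirDeriv closedSquare (inwardNormal z₀ i) u) z =
      dirDeriv closedSquare (EuclideanSpace.single i 1)
        (dirDeriv closedSquare (EuclideanSpace.single i 1) u) z := by
  have hπ := Real.pi_div_two_pos.ne'
  rcases eq_or_eq_neg_of_abs_eq (hz₀ i) with hi | hi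
  · rw [inwardNormal, hi, div_self hπ, neg_one_smul,
      dirDeriv_dirDeriv_neg_direction uniqueDiffOn_closedSquare hz]
  · rw [inwardNormal, hi, neg_div, div_self hπ, neg_neg, one_smul]

theorem laplacian_eq_sum_dirDeriv_inwardNormal (hz₀ : IsCorner z₀) (hz : z ∈ square)
    (hu : ContDiffWithinAt ℝ 2 u closedSquare z) :
    Laplacian.laplacian u z = ∑ i : Fin 2, dirDeriv closedSquare (inwardNormal z₀ i)
      (dirDeriv closedSquare (inwardNormal z₀ i) u) z := by
  have hzS := square_subset_closedSquare hz
  have hat : ContDiffAt ℝ 2 u z :=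
    hu.contDiffAt (mem_of_superset (isOpen_square.mem_nhds hz) square_subset_closedSquare)
  rw [InnerProductSpace.laplacian_eq_iteratedFDeriv_orthonormalBasis u
    (EuclideanSpace.basisFun (Fin 2) ℝ)]
  refine Finset.sum_congr rfl fun i _ => ?_
  rw [dirDeriv_dirDeriv_inwardNormal hz₀ i hzS,
    ← iteratedFDerivWithin_two_eq_dirDeriv uniqueDiffOn_closedSquare hzS hu,
    iteratedFDerivWithin_eq_iteratedFDeriv uniqueDiffOn_closedSquare hat hzS,
    EuclideanSpace.basisFun_apply]

theorem neg_sum_dirDeriv_inwardNormal_eq (hz₀ : IsCorner z₀) (hU : IsOpen U)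
    (hu : ∀ z ∈ closedSquare ∩ U, ContDiffWithinAt ℝ 2 u closedSquare z)
    (heq : ∀ z ∈ U ∩ square, -(Laplacian.laplacian u z) = lam * u z)
    (hz : z ∈ closedSquare ∩ U) :
    -∑ i : Fin 2, dirDeriv closedSquare (inwardNormal z₀ i)
      (dirDeriv closedSquare (inwardNormal z₀ i) u) z = lam * u z := by
  have hsub : U ∩ square ⊆ closedSquare ∩ U := fun w hw =>
    ⟨square_subset_closedSquare hw.2, hw.1⟩
  have hcont : ContinuousOn (fun w => -∑ i : Fin 2, dirDeriv closedSquare (inwardNormal z₀ i)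
      (dirDeriv closedSquare (inwardNormal z₀ i) u) w) (closedSquare ∩ U) := by
    refine (continuousOn_finsetSum _ fun i _ w hw => ?_).neg
    have hfirst := contDiffWithinAt_dirDeriv (m := 1) uniqueDiffOn_closedSquare hw.1 (hu w hw)
      (by norm_num) (inwardNormal z₀ i)
    exact (contDiffWithinAt_dirDeriv (m := 0) uniqueDiffOn_closedSquare hw.1 hfirst
      (by norm_num) _).continuousWithinAt.mono inter_subset_left
  have hcont_u : ContinuousOn u (closedSquare ∩ U) := fun w hw =>
    (hu w hw).continuousWithinAt.mono inter_subset_left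
  refine EqOn.of_subset_closure (fun w hw => ?_) hcont (hcont_u.const_mul lam) hsub
    (closedSquare_inter_subset_closure hU) hz
  rw [← laplacian_eq_sum_dirDeriv_inwardNormal hz₀ hw.2 (hu w (hsub hw)), heq w hw]

theorem exists_dirDeriv_dirDeriv_inwardNormal_neg_pos (hz₀ : IsCorner z₀) (hU : IsOpen U)
    (hz₀U : z₀ ∈ U) (hu : ∀ z ∈ closedSquare ∩ U, ContDiffWithinAt ℝ 2 u closedSquare z)
    (heq : ∀ z ∈ U ∩ square, -(Laplacian.laplacian u z) = lam * u z) (hzero : u z₀ = 0)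
    (hyy : iteratedFDerivWithin ℝ 2 u closedSquare z₀
      ![EuclideanSpace.single 1 1, EuclideanSpace.single 1 1] ≠ 0) :
    ∃ i j : Fin 2, i ≠ j ∧
      dirDeriv closedSquare (inwardNormal z₀ i) (dirDeriv closedSquare (inwardNormal z₀ i) u) z₀
        < 0 ∧
      0 < dirDeriv closedSquare (inwardNormal z₀ j)
        (dirDeriv closedSquare (inwardNormal z₀ j) u) z₀ := by
  have hz₀S := hz₀.mem_closedSquare
  have hsum := neg_sum_dirDeriv_inwardNormal_eq hz₀ hU hu heq ⟨hz₀S, hz₀U⟩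
  rw [Fin.sum_univ_two, hzero, mul_zero] at hsum
  rw [iteratedFDerivWithin_two_eq_dirDeriv uniqueDiffOn_closedSquare hz₀S (hu z₀ ⟨hz₀S, hz₀U⟩),
    ← dirDeriv_dirDeriv_inwardNormal hz₀ 1 hz₀S] at hyy
  rcases lt_or_gt_of_ne hyy with hlt | hgt
  · exact ⟨1, 0, one_ne_zero, hlt, by linarith⟩
  · exact ⟨0, 1, zero_ne_one, by linarith, hgt⟩

end Laplacian

section Family

variable {T : Type*} {A : Set T} {τ₀ : T} {u : T → Plane → ℝ} {ρ : T → ℝ}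

theorem eventually_ncard_nodalDomains_corner [TopologicalSpace T] {z₀ : Plane} {i j : Fin 2} {r : ℝ}
    (hz₀ : IsCorner z₀) (hij : i ≠ j) (hr : 0 < r) (hrπ : r ≤ Real.pi) (hτ₀ : τ₀ ∈ A)
    (hu : ∀ τ ∈ A, IsRobinOn (ρ τ) (Metric.ball z₀ r) (u τ))
    (hcont : ∀ z ∈ Metric.ball z₀ r ∩ square, ContinuousWithinAt (fun τ => u τ z) A τ₀)
    (hi : ∀ᶠ τ in 𝓝[A] τ₀,
      HasDecreasingFlux (ρ τ) (inwardNormal z₀ i) (Metric.ball z₀ r) (u τ))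
    (hj : ∀ᶠ τ in 𝓝[A] τ₀,
      HasDecreasingFlux (ρ τ) (inwardNormal z₀ j) (Metric.ball z₀ r) (-u τ))
    (hzero : u τ₀ z₀ = 0) :
    ∀ᶠ τ in 𝓝[A] τ₀, (nodalDomains (u τ) (Metric.ball z₀ r ∩ square)).ncard = 2 := by
  obtain ⟨n, hn, hun⟩ := exists_neg_of_hasDecreasingFlux hz₀ hr hrπ (hu τ₀ hτ₀)
    (hi.self_of_nhdsWithin hτ₀) hzero
  obtain ⟨p, hp, hup⟩ := exists_neg_of_hasDecreasingFlux hz₀ hr hrπ (hu τ₀ hτ₀).neg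
    (hj.self_of_nhdsWithin hτ₀) (by rw [Pi.neg_apply, hzero, neg_zero])
  rw [Pi.neg_apply, neg_lt_zero] at hup
  filter_upwards [hi, hj, (hcont n hn).eventually_lt_const hun,
    (hcont p hp).eventually_const_lt hup, self_mem_nhdsWithin] with τ hiτ hjτ hunτ hupτ hτ
  exact ncard_nodalDomains_corner hz₀ hij hr hrπ (hu τ hτ) hiτ hjτ ⟨p, hp, hupτ⟩ ⟨n, hn, hunτ⟩

theorem contDiffWithinAt_of_contDiffOn_inter_prod {E : Type*} [NormedAddCommGroup E]
    [NormedSpace ℝ E] [NormedAddCommGroup T] [NormedSpace ℝ T] {f : E × T → ℝ} {n : ℕ∞ω}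
    {S U : Set E} {p : E × T} (hU : IsOpen U) (hf : ContDiffOn ℝ n f ((S ∩ U) ×ˢ A))
    (hp : p ∈ (S ∩ U) ×ˢ A) : ContDiffWithinAt ℝ n f (S ×ˢ A) p := by
  refine (hf p hp).mono_of_mem_nhdsWithin ?_
  rw [← p.eta, nhdsWithin_prod_eq]
  exact prod_mem_prod (inter_mem_nhdsWithin S (hU.mem_nhds hp.1.2)) self_mem_nhdsWithin

theorem exists_eventually_hasDecreasingFlux [NormedAddCommGroup T] [NormedSpace ℝ T] {z : Plane}
    (hz : z ∈ closedSquare) (hτ₀ : τ₀ ∈ A)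
    (hu : ContDiffWithinAt ℝ 2 (fun p : Plane × T => u p.2 p.1) (closedSquare ×ˢ A) (z, τ₀))
    (hρ : ContinuousWithinAt ρ A τ₀) {v : Plane}
    (hlt : dirDeriv closedSquare v (dirDeriv closedSquare v (u τ₀)) z <
      ρ τ₀ * dirDeriv closedSquare v (u τ₀) z) :
    ∃ R > 0, ∀ᶠ τ in 𝓝[A] τ₀, HasDecreasingFlux (ρ τ) v (Metric.ball z R) (u τ) := by
  have hfirst := contDiffWithinAt_uncurry_dirDeriv (m := 1) uniqueDiffOn_closedSquare hz hτ₀ hu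
    (by norm_num) v
  have hsecond := contDiffWithinAt_uncurry_dirDeriv (m := 0) uniqueDiffOn_closedSquare hz hτ₀
    (u := fun τ => dirDeriv closedSquare v (u τ)) hfirst (by norm_num) v
  have hρ' : ContinuousWithinAt (fun p : Plane × T => ρ p.2) (closedSquare ×ˢ A) (z, τ₀) :=
    hρ.comp continuousWithinAt_snd fun p hp => hp.2
  have hnear := hsecond.continuousWithinAt.eventually_lt (hρ'.mul hfirst.continuousWithinAt) hlt
  rw [nhdsWithin_prod_eq, eventually_prod_iff] at hnear
  obtain ⟨pz, hpz, pτ, hpτ, hprod⟩ := hnear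
  obtain ⟨R, hR, hball⟩ := Metric.mem_nhdsWithin_iff.1 hpz
  exact ⟨R, hR, hpτ.mono fun τ hτ w hw => hprod (hball ⟨hw.2, hw.1⟩) hτ⟩

theorem exists_eventually_hasDecreasingFlux_corner [NormedAddCommGroup T] [NormedSpace ℝ T]
    {z₀ : Plane} {ε lam : ℝ} (hz₀ : IsCorner z₀) (hε : 0 < ε) (hτ₀ : τ₀ ∈ A)
    (hsmooth : ContDiffWithinAt ℝ 2 (fun p : Plane × T => u p.2 p.1) (closedSquare ×ˢ A) (z₀, τ₀))
    (hρ : ContinuousWithinAt ρ A τ₀) (hu : IsRobinOn (ρ τ₀) (Metric.ball z₀ ε) (u τ₀))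
    (heq : ∀ z ∈ Metric.ball z₀ ε ∩ square, -(Laplacian.laplacian (u τ₀) z) = lam * u τ₀ z)
    (hzero : u τ₀ z₀ = 0)
    (hyy : iteratedFDerivWithin ℝ 2 (u τ₀) closedSquare z₀
      ![EuclideanSpace.single 1 1, EuclideanSpace.single 1 1] ≠ 0) :
    ∃ i j : Fin 2, i ≠ j ∧ ∃ R > 0, ∀ᶠ τ in 𝓝[A] τ₀,
      HasDecreasingFlux (ρ τ) (inwardNormal z₀ i) (Metric.ball z₀ R) (u τ) ∧
      HasDecreasingFlux (ρ τ) (inwardNormal z₀ j) (Metric.ball z₀ R) (-u τ) := by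
  have hz₀S := hz₀.mem_closedSquare
  obtain ⟨i, j, hij, hi, hj⟩ := exists_dirDeriv_dirDeriv_inwardNormal_neg_pos hz₀ Metric.isOpen_ball
    (Metric.mem_ball_self hε) hu.contDiffWithinAt heq hzero hyy
  have hgrad : ∀ k, dirDeriv closedSquare (inwardNormal z₀ k) (u τ₀) z₀ = 0 := fun k => by
    rw [hu.dirDeriv_inwardNormal_corner hz₀ hε, hzero, mul_zero]
  obtain ⟨R, hR, hfluxi⟩ := exists_eventually_hasDecreasingFlux (v := inwardNormal z₀ i) hz₀S hτ₀
    hsmooth hρ (by rwa [hgrad, mul_zero])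
  obtain ⟨R', hR', hfluxj⟩ := exists_eventually_hasDecreasingFlux (u := fun τ => -u τ)
    (v := inwardNormal z₀ j) hz₀S hτ₀ hsmooth.neg hρ (by
      rwa [dirDeriv_neg uniqueDiffOn_closedSquare hz₀S, hgrad, neg_zero, mul_zero,
        dirDeriv_dirDeriv_neg uniqueDiffOn_closedSquare hz₀S, neg_lt_zero])
  refine ⟨i, j, hij, min R R', lt_min hR hR', ?_⟩
  filter_upwards [hfluxi, hfluxj] with τ hτi hτj
  exact ⟨hτi.mono (Metric.ball_subset_ball (min_le_left _ _)),
    hτj.mono (Metric.ball_subset_ball (min_le_right _ _))⟩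

end Family

theorem exists_forall_of_eventually_nhdsWithin {θ₀ h₀ η₁ : ℝ} (hh₀ : 0 < h₀) (hη₁ : 0 < η₁)
    {p : ℝ × ℝ → Prop} (hp : ∀ᶠ τ in 𝓝[Ioo (θ₀ - η₁) (θ₀ + η₁) ×ˢ Ico 0 h₀] (θ₀, 0), p τ) :
    ∃ η₀ : ℝ, 0 < η₀ ∧ η₀ < η₁ ∧ η₀ < h₀ ∧
      ∀ θ h : ℝ, 0 ≤ h → |θ - θ₀| + h ≤ η₀ → p (θ, h) := by
  obtain ⟨δ, hδ, hball⟩ := Metric.mem_nhdsWithin_iff.1 hp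
  obtain ⟨η₀, hη₀, hlt⟩ := exists_between (lt_min hδ (lt_min hη₁ hh₀))
  obtain ⟨hη₀δ, hη₀η₁, hη₀h₀⟩ := by simpa only [lt_min_iff] using hlt
  refine ⟨η₀, hη₀, hη₀η₁, hη₀h₀, fun θ h hh hle => hball ⟨?_, ?_, hh, ?_⟩⟩
  · rw [Metric.mem_ball, Prod.dist_eq, max_lt_iff, Real.dist_eq, Real.dist_eq, sub_zero,
      abs_of_nonneg hh]
    constructor <;> linarith [abs_nonneg (θ - θ₀)]
  · rw [← Real.ball_eq_Ioo, Metric.mem_ball, Real.dist_eq]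
    linarith
  · linarith [abs_nonneg (θ - θ₀)]

end RobinSquare

open RobinSquare Filter Metric Topology in
theorem mainTheorem6_general {T : Type*} [NormedAddCommGroup T] [NormedSpace ℝ T] {A : Set T}
    {τ₀ : T} (hτ₀ : τ₀ ∈ A) {u : T → Plane → ℝ} {ρ : T → ℝ} {lam ε : ℝ} {z₀ : Plane}
    (hz₀ : IsCorner z₀) (hε : 0 < ε)
    (hsmooth : ContDiffOn ℝ 2 (fun p : Plane × T => u p.2 p.1) ((closedSquare ∩ ball z₀ ε) ×ˢ A))
    (hρ : ContinuousWithinAt ρ A τ₀)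
    (hrobin : ∀ τ ∈ A, ∀ z ∈ ball z₀ ε, ∀ ν, IsOutwardNormal z ν →
      fderivWithin ℝ (u τ) closedSquare z ν + ρ τ * u τ z = 0)
    (heq : ∀ z ∈ ball z₀ ε ∩ square, -(Laplacian.laplacian (u τ₀) z) = lam * u τ₀ z)
    (hzero : u τ₀ z₀ = 0)
    (hyy : iteratedFDerivWithin ℝ 2 (u τ₀) closedSquare z₀
      ![EuclideanSpace.single 1 1, EuclideanSpace.single 1 1] ≠ 0) :
    ∃ ε₀ : ℝ, 0 < ε₀ ∧ ε₀ < ε ∧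
      ∀ᶠ τ in 𝓝[A] τ₀, (nodalDomains (u τ) (ball z₀ ε₀ ∩ square)).ncard = 2 := by
  have hsm := fun p hp =>
    contDiffWithinAt_of_contDiffOn_inter_prod (p := p) isOpen_ball hsmooth hp
  have hu : ∀ τ ∈ A, IsRobinOn (ρ τ) (ball z₀ ε) (u τ) := fun τ hτ =>
    ⟨fun z hz => (hsm (z, τ) ⟨hz, hτ⟩).comp (f := fun w => (w, τ)) z (by fun_prop)
      fun w hw => ⟨hw, hτ⟩, hrobin τ hτ⟩
  obtain ⟨i, j, hij, R, hR, hflux⟩ := exists_eventually_hasDecreasingFlux_corner hz₀ hε hτ₀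
    (hsm (z₀, τ₀) ⟨⟨hz₀.mem_closedSquare, mem_ball_self hε⟩, hτ₀⟩) hρ (hu τ₀ hτ₀) heq hzero hyy
  obtain ⟨r, hr, hlt⟩ := exists_between (lt_min hR (lt_min hε Real.pi_pos))
  obtain ⟨hrR, hrε, hrπ⟩ := by simpa only [lt_min_iff] using hlt
  refine ⟨r, hr, hrε, eventually_ncard_nodalDomains_corner hz₀ hij hr hrπ.le hτ₀
    (fun τ hτ => (hu τ hτ).mono (ball_subset_ball hrε.le)) (fun z hz => ?_)
    (hflux.mono fun τ hτ => hτ.1.mono (ball_subset_ball hrR.le))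
    (hflux.mono fun τ hτ => hτ.2.mono (ball_subset_ball hrR.le)) hzero⟩
  have hzS := square_subset_closedSquare hz.2
  exact (hsm (z, τ₀) ⟨⟨hzS, ball_subset_ball hrε.le hz.1⟩, hτ₀⟩).continuousWithinAt.comp
    (f := fun τ => (z, τ)) (by fun_prop) fun τ hτ => ⟨hzS, hτ⟩

theorem mainTheorem6
    (Φ : RobinSquare.Plane → ℝ → ℝ → ℝ) (lam : ℝ → ℝ)
    (z₀ : RobinSquare.Plane) (hz₀ : RobinSquare.IsCorner z₀)
    (θ₀ h₀ ε₁ η₁ : ℝ) (hh₀ : 0 < h₀) (hε₁ : 0 < ε₁) (hη₁ : 0 < η₁)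
    -- a `C^∞` family, up to the boundary, near the corner
    (hsmooth : ContDiffOn ℝ ∞
      (fun p : RobinSquare.Plane × ℝ × ℝ => Φ p.1 p.2.1 p.2.2)
      ((RobinSquare.closedSquare ∩ Metric.ball z₀ ε₁) ×ˢ
        (Set.Ioo (θ₀ - η₁) (θ₀ + η₁) ×ˢ Set.Ico 0 h₀)))
    -- of Robin eigenfunctions, the eigenvalue depending on `h` only
    (heigen : ∀ θ ∈ Set.Ioo (θ₀ - η₁) (θ₀ + η₁), ∀ h ∈ Set.Ico 0 h₀,
      RobinSquare.IsRobinEigenfunction h (lam h) (fun z => Φ z θ h))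
    -- at `θ₀` it vanishes on the diagonal of the square through `z₀`
    (hdiag : ∀ h ∈ Set.Ico 0 h₀, ∀ t ∈ Set.Icc (-1 : ℝ) 1, Φ (t • z₀) θ₀ h = 0)
    -- `∇Φ(z₀, θ₀, h) = 0`
    (hcrit : ∀ h ∈ Set.Ico 0 h₀,
      fderivWithin ℝ (fun z => Φ z θ₀ h) RobinSquare.closedSquare z₀ = 0)
    -- `∂²Φ/∂y² (z₀, θ₀, 0) ≠ 0`
    (hyy : iteratedFDerivWithin ℝ 2 (fun z => Φ z θ₀ 0) RobinSquare.closedSquare z₀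
      ![EuclideanSpace.single 1 1, EuclideanSpace.single 1 1] ≠ 0)
    -- `∂Φ/∂θ (z₀, θ₀, 0) ≠ 0`
    (hθ : deriv (fun θ => Φ z₀ θ 0) θ₀ ≠ 0) :
    ∃ ε₀ η₀ : ℝ, 0 < ε₀ ∧ ε₀ < ε₁ ∧ 0 < η₀ ∧ η₀ < η₁ ∧ η₀ < h₀ ∧
      ∀ θ h : ℝ, 0 ≤ h → |θ - θ₀| + h ≤ η₀ →
        (RobinSquare.nodalDomains (fun z => Φ z θ h)
          (Metric.ball z₀ ε₀ ∩ RobinSquare.square)).ncard = 2 := by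
  have hτ₀ : (θ₀, (0 : ℝ)) ∈ Set.Ioo (θ₀ - η₁) (θ₀ + η₁) ×ˢ Set.Ico 0 h₀ :=
    ⟨by simpa using hη₁, Set.left_mem_Ico.2 hh₀⟩
  obtain ⟨ε₀, hε₀, hε₀ε₁, hcount⟩ := mainTheorem6_general (u := fun τ z => Φ z τ.1 τ.2) hτ₀ hz₀ hε₁
    (contDiffOn_infty.1 hsmooth 2) continuousWithinAt_snd
    (fun τ hτ z _ => (heigen τ.1 hτ.1 τ.2 hτ.2).robin z)
    (fun z hz => (heigen θ₀ hτ₀.1 0 hτ₀.2).equation z hz.2)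
    (by simpa using hdiag 0 hτ₀.2 1 (by norm_num)) hyy
  obtain ⟨η₀, hη₀, hη₀η₁, hη₀h₀, hall⟩ :=
    RobinSquare.exists_forall_of_eventually_nhdsWithin hh₀ hη₁ hcount
  exact ⟨ε₀, η₀, hε₀, hε₀ε₁, hη₀, hη₀η₁, hη₀h₀, hall⟩
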